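/- \textbf{Theorem 1.2.} Let $G$ be a finitely generated abelian-by-nilpotent-by-nilpotent group (that is, $G\in\mathcal U\mathcal N\mathcal N$): $G$ has a normal subgroup $N$ with $G/N$ nilpotent, and $N$ has an abelian normal subgroup $A$ with $N/A$ nilpotent. Let $X$ be any generating set of $G$. A palindrome in $X^{\pm1}$ is an element of $G$ represented by a reduced word in the alphabet $X^{\pm1}$ that reads the same forwards and backwards. For $g\in G$ let $l_{\mathcal P}(g)$ be the least $k$ such that $g$ is a product of $k$ palindromes in $X^{\pm1}$, and let $\mathrm{pw}(G,X)=\sup_{g\in G} l_{\mathcal P}(g)$ be the palindromic width of $G$ with respect to $X$. Then $\mathrm{pw}(G,X)<\infty$. -/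

import Mathlib

universe u

/-- A class of groups. -/
def GroupClass : Type (u + 1) := (G : Type u) → [Group G] → Prop

namespace GroupClass

/-- The class `𝒰` of abelian groups. -/
def abelian : GroupClass.{u} := fun G _ => IsMulCommutative G

/-- The class `𝒩` of nilpotent groups (of arbitrary nilpotency class). -/
def nilpotent : GroupClass.{u} := fun G _ => Group.IsNilpotent G

/-- The product class `C D`: groups with a normal subgroup `N` in `C` whose quotient lies in `D`. -/
def prod (C D : GroupClass.{u}) : GroupClass.{u} := fun G _ =>
  ∃ (N : Subgroup G) (_ : N.Normal), C N ∧ D (G ⧸ N)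

/-- The class `𝒰𝒩𝒩` of abelian-by-nilpotent-by-nilpotent groups. -/
def abelianByNilpotentByNilpotent : GroupClass.{u} :=
  prod (prod abelian nilpotent) nilpotent

end GroupClass

section Palindromes

variable {G : Type u} [Group G]

/-- The element of `G` represented by a word in the alphabet `X^{±1}`; the letter `(x, true)`
stands for `x` and `(x, false)` for `x⁻¹`. -/
def wordValue (X : Set G) (w : List (X × Bool)) : G :=
  (w.map fun a => if a.2 then (a.1 : G) else (a.1 : G)⁻¹).prod

/-- `g` is represented by a reduced word in `X^{±1}` that reads the same forwards and backwards. -/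
def IsPalindromeIn (X : Set G) (g : G) : Prop :=
  ∃ w : List (X × Bool), FreeGroup.IsReduced w ∧ w.reverse = w ∧ wordValue X w = g

/-- The least `k` such that `g` is a product of `k` palindromes in `X^{±1}` (`⊤` if there is
none). -/
noncomputable def palindromicLength (X : Set G) (g : G) : ℕ∞ :=
  sInf {k : ℕ∞ | ∃ l : List G, (∀ p ∈ l, IsPalindromeIn X p) ∧ l.prod = g ∧ (l.length : ℕ∞) = k}

/-- The palindromic width of `G` with respect to `X`. -/
noncomputable def palindromicWidth (X : Set G) : ℕ∞ :=
  ⨆ g : G, palindromicLength X g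

end Palindromes

/-! A conjugate of a palindrome is a product of two palindromes, so for fixed `y` all commutators
`⁅u, y⁆` have bounded palindromic length, whatever `u` is. It remains to write each element with
boundedly many such commutators and powers of generators.

The engine is `exists_commutator_subset_pow`. If `B` centralizes `D = ⁅B, N⁆` and `N` is the normal
closure of a finite set `Y`, then `D` is abelian and `b ↦ ⁅b, y⁆`, `d ↦ ⁅d, x⁆` are homomorphisms
into `D`. Their finitely many images have join `D`, and each consists of commutators with one fixed
element. Modulo `C` this gives `boundedModulo_commutator`.

Powers of generators cover `G` modulo `⁅G, G⁆`. With `N` a term of the lower central series of `G`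
that has an abelian lower central term, such steps lead from `⁅G, G⁆` to `⁅N, G⁆`, then to `⁅N, N⁆`,
and down the lower central series of `N` to `⊥`. `N` need not be finitely generated, only finitely
generated as a normal subgroup. -/

open scoped Pointwise commutatorElement IsMulCommutative

/-! ### Reversal and free reduction -/

section FreeGroupWords

variable {α : Type*}

theorem FreeGroup.Red.Step.reverse {L₁ L₂ : List (α × Bool)} (h : FreeGroup.Red.Step L₁ L₂) :
    FreeGroup.Red.Step L₁.reverse L₂.reverse := by
  obtain ⟨⟩ := h
  simp

theorem FreeGroup.Red.reverse {L₁ L₂ : List (α × Bool)} (h : FreeGroup.Red L₁ L₂) :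
    FreeGroup.Red L₁.reverse L₂.reverse :=
  Relation.ReflTransGen.lift List.reverse (fun _ _ => FreeGroup.Red.Step.reverse) L₁ L₂ h

/-- Reversal carries reductions to reductions, and a reduced word reduces only to itself. -/
theorem FreeGroup.reduce_reverse [DecidableEq α] (w : List (α × Bool)) :
    FreeGroup.reduce w.reverse = (FreeGroup.reduce w).reverse := by
  have h₁ : FreeGroup.reduce w.reverse = FreeGroup.reduce (FreeGroup.reduce w).reverse :=
    FreeGroup.reduce.eq_of_red FreeGroup.reduce.red.reverse
  have h₂ : FreeGroup.Red (FreeGroup.reduce w) (FreeGroup.reduce w.reverse).reverse := by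
    have h := (FreeGroup.reduce.red (L := (FreeGroup.reduce w).reverse)).reverse
    rwa [List.reverse_reverse, ← h₁] at h
  rw [FreeGroup.reduce.min h₂, List.reverse_reverse]

end FreeGroupWords

/-! ### Palindromes, their conjugates and commutators -/

section PalindromicWords

variable {G : Type u} [Group G] {X : Set G}

theorem wordValue_append (v w : List (X × Bool)) :
    wordValue X (v ++ w) = wordValue X v * wordValue X w := by
  simp [wordValue]

theorem wordValue_eq_lift (w : List (X × Bool)) :
    wordValue X w = FreeGroup.lift (fun x : X => (x : G)) (FreeGroup.mk w) := by
  rw [FreeGroup.lift_mk, wordValue]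
  congr 2
  funext a
  cases a.2 <;> rfl

theorem wordValue_invRev (w : List (X × Bool)) :
    wordValue X (FreeGroup.invRev w) = (wordValue X w)⁻¹ := by
  rw [wordValue_eq_lift, wordValue_eq_lift, ← map_inv, FreeGroup.inv_mk]

theorem exists_wordValue_eq (hX : Subgroup.closure X = ⊤) (g : G) :
    ∃ w : List (X × Bool), wordValue X w = g := by
  have hg : g ∈ Subgroup.closure X := hX ▸ Subgroup.mem_top g
  induction hg using Subgroup.closure_induction with
  | mem x hx => exact ⟨[(⟨x, hx⟩, true)], by simp [wordValue]⟩
  | one => exact ⟨[], by simp [wordValue]⟩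
  | mul a b _ _ ha hb =>
    obtain ⟨v, rfl⟩ := ha
    obtain ⟨w, rfl⟩ := hb
    exact ⟨v ++ w, wordValue_append v w⟩
  | inv a _ ha =>
    obtain ⟨v, rfl⟩ := ha
    exact ⟨_, wordValue_invRev v⟩

/-- A palindromic word need not be reduced to represent a palindrome. -/
theorem isPalindromeIn_wordValue {w : List (X × Bool)} (hw : w.reverse = w) :
    IsPalindromeIn X (wordValue X w) := by
  classical
  refine ⟨FreeGroup.reduce w, ?_, ?_, ?_⟩
  · rw [FreeGroup.isReduced_iff_reduce_eq, FreeGroup.reduce.idem]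
  · rw [← FreeGroup.reduce_reverse, hw]
  · rw [wordValue_eq_lift, wordValue_eq_lift, FreeGroup.reduce.self]

theorem isPalindromeIn_one : IsPalindromeIn X (1 : G) :=
  isPalindromeIn_wordValue (w := []) rfl

theorem isPalindromeIn_pow {x : G} (hx : x ∈ X) (b : Bool) (n : ℕ) :
    IsPalindromeIn X ((if b then x else x⁻¹) ^ n) := by
  have h := isPalindromeIn_wordValue (X := X) (w := List.replicate n (⟨x, hx⟩, b)) (by simp)
  simpa [wordValue] using h

theorem isPalindromeIn_zpow {x : G} (hx : x ∈ X) (k : ℤ) : IsPalindromeIn X (x ^ k) := by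
  obtain ⟨n, rfl | rfl⟩ := k.eq_nat_or_neg
  · simpa using isPalindromeIn_pow hx true n
  · simpa using isPalindromeIn_pow hx false n

theorem IsPalindromeIn.inv {p : G} (hp : IsPalindromeIn X p) : IsPalindromeIn X p⁻¹ := by
  obtain ⟨w, -, hw, rfl⟩ := hp
  rw [← wordValue_invRev]
  refine isPalindromeIn_wordValue ?_
  rw [FreeGroup.invRev, ← List.map_reverse, hw, ← List.map_reverse, hw]

/-- A conjugate `u p u⁻¹` of a palindrome is `(u p ū) (ū⁻¹ u⁻¹)`, where `ū` is the reverse of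
a word for `u`. -/
theorem IsPalindromeIn.conj_mem_pow_two (hX : Subgroup.closure X = ⊤) {p : G}
    (hp : IsPalindromeIn X p) (u : G) : u * p * u⁻¹ ∈ {g | IsPalindromeIn X g} ^ 2 := by
  obtain ⟨v, rfl⟩ := exists_wordValue_eq hX u
  obtain ⟨w, -, hw, rfl⟩ := hp
  rw [pow_two]
  refine ⟨_, isPalindromeIn_wordValue (w := v ++ w ++ v.reverse) (by simp [hw]), _,
    isPalindromeIn_wordValue (w := FreeGroup.invRev v.reverse ++ FreeGroup.invRev v)
      (by simp [FreeGroup.invRev]), ?_⟩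
  simp only [wordValue_append, wordValue_invRev]
  group

theorem conj_mem_pow_two_mul (hX : Subgroup.closure X = ⊤) (n : ℕ) :
    ∀ {y : G}, y ∈ {g | IsPalindromeIn X g} ^ n → ∀ u : G,
      u * y * u⁻¹ ∈ {g | IsPalindromeIn X g} ^ (2 * n) := by
  induction n with
  | zero =>
    intro y hy u
    have : y = 1 := by simpa using hy
    simp [this]
  | succ n ih =>
    intro y hy u
    rw [pow_succ] at hy
    obtain ⟨a, ha, p, hp, rfl⟩ := hy
    rw [mul_add, pow_add]
    refine ⟨_, ih ha u, _, IsPalindromeIn.conj_mem_pow_two hX hp u, ?_⟩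
    simp only
    group

theorem exists_mem_pow_palindromes (hX : Subgroup.closure X = ⊤) (y : G) :
    ∃ n : ℕ, y ∈ {g | IsPalindromeIn X g} ^ n := by
  obtain ⟨w, rfl⟩ := exists_wordValue_eq hX y
  induction w with
  | nil => exact ⟨0, by simp [wordValue]⟩
  | cons a w ih =>
    obtain ⟨n, hn⟩ := ih
    refine ⟨1 + n, ?_⟩
    rw [pow_add, pow_one]
    refine ⟨_, isPalindromeIn_wordValue (w := [a]) rfl, _, hn, ?_⟩
    exact (wordValue_append [a] w).symm

/-- The commutators with a fixed element have bounded palindromic length. -/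
theorem exists_forall_commutator_mem_pow_palindromes (hX : Subgroup.closure X = ⊤) (y : G) :
    ∃ n : ℕ, ∀ u : G, ⁅u, y⁆ ∈ {g | IsPalindromeIn X g} ^ n := by
  obtain ⟨n, hn⟩ := exists_mem_pow_palindromes hX y
  obtain ⟨m, hm⟩ := exists_mem_pow_palindromes hX y⁻¹
  refine ⟨2 * n + m, fun u => ?_⟩
  rw [pow_add]
  exact ⟨_, conj_mem_pow_two_mul hX n hn u, _, hm, rfl⟩

end PalindromicWords

/-! ### Bounded products modulo a subgroup -/

section BoundedWidth

variable {G : Type*} [Group G] {P : Set G}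

/-- A join of finitely many subgroups of an abelian group has bounded width if each of them has. -/
theorem exists_image_iSup_subset_pow {A : Type*} [CommGroup A] (φ : A →* G) {ι : Type*} [Finite ι] (H : ι → Subgroup A) (h : ∀ i, ∃ n : ℕ, φ '' (H i) ⊆ P ^ n) :
    ∃ n : ℕ, φ '' (⨆ i, H i : Subgroup A) ⊆ P ^ n := by
  classical
  have := Fintype.ofFinite ι
  suffices hs : ∀ s : Finset ι, ∃ n : ℕ, φ '' (⨆ i ∈ s, H i : Subgroup A) ⊆ P ^ n by
    simpa using hs Finset.univ
  intro s
  induction s using Finset.induction with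
  | empty => exact ⟨0, by simp⟩
  | insert i s _ ih =>
    obtain ⟨n, hn⟩ := ih
    obtain ⟨m, hm⟩ := h i
    refine ⟨m + n, ?_⟩
    rintro _ ⟨a, ha, rfl⟩
    rw [Finset.iSup_insert] at ha
    obtain ⟨b, hb, c, hc, rfl⟩ := Subgroup.mem_sup.1 ha
    rw [pow_add, map_mul]
    exact Set.mul_mem_mul (hm ⟨b, hb, rfl⟩) (hn ⟨c, hc, rfl⟩)

/-- If `D` is normal, `S ≤ D`, and `S` contains the commutators of the elements of a generating
set with those of `D`, then it contains `⁅⊤, D⁆`. -/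
theorem commutator_top_le_of_closure {X : Set G} (hX : Subgroup.closure X = ⊤) {D S : Subgroup G}
    [D.Normal] (hS : S ≤ D) (h : ∀ x ∈ X, ∀ d ∈ D, ⁅x, d⁆ ∈ S) : ⁅(⊤ : Subgroup G), D⁆ ≤ S := by
  rw [Subgroup.commutator_le]
  intro g _
  have hg : g ∈ Subgroup.closure X := hX ▸ Subgroup.mem_top g
  induction hg using Subgroup.closure_induction with
  | mem x hx => exact h x hx
  | one => simp
  | mul a b _ _ ha hb =>
    intro d hd
    have e : ⁅a * b, d⁆ = ⁅a, ⁅b, d⁆⁆ * ⁅b, d⁆ * ⁅a, d⁆ := by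
      simp only [commutatorElement_def]; group
    rw [e]
    -- Since `S ≤ D`, the hypothesis on `a` also applies to `⁅b, d⁆`.
    have hbd := hb trivial d hd
    exact mul_mem (mul_mem (ha trivial _ (hS hbd)) hbd) (ha trivial d hd)
  | inv a _ ha =>
    intro d hd
    have e : ⁅a⁻¹, d⁆ = ⁅a, a⁻¹ * d * a⁆⁻¹ := by
      simp only [commutatorElement_def]; group
    rw [e]
    refine inv_mem (ha trivial _ ?_)
    simpa using ‹D.Normal›.conj_mem d hd a⁻¹

/-- Modulo `S`, the centralizer of the image of `B` is normal, so it absorbs the normal closure once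
it contains `Y`. -/
theorem commutator_normalClosure_le {Y : Set G} {B S : Subgroup G} [B.Normal] [S.Normal]
    (h : ∀ b ∈ B, ∀ y ∈ Y, ⁅b, y⁆ ∈ S) : ⁅B, Subgroup.normalClosure Y⁆ ≤ S := by
  have hB : ∀ y ∈ Y, y ∈ (Subgroup.centralizer
      (B.map (QuotientGroup.mk' S) : Set (G ⧸ S))).comap (QuotientGroup.mk' S) := by
    intro y hy
    rw [Subgroup.mem_comap, Subgroup.mem_centralizer_iff]
    rintro _ ⟨b, hb, rfl⟩
    rw [← commutatorElement_eq_one_iff_mul_comm, ← map_commutatorElement]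
    exact (QuotientGroup.eq_one_iff _).2 (h b hb y hy)
  have : (B.map (QuotientGroup.mk' S)).Normal :=
    Subgroup.Normal.map ‹_› _ (QuotientGroup.mk'_surjective S)
  have hN := Subgroup.normalClosure_le_normal (N := (Subgroup.centralizer
      (B.map (QuotientGroup.mk' S) : Set (G ⧸ S))).comap (QuotientGroup.mk' S)) hB
  rw [Subgroup.commutator_le]
  intro b hb n hn
  have hc := Subgroup.mem_centralizer_iff.1 (hN hn) _ ⟨b, hb, rfl⟩
  rw [← commutatorElement_eq_one_iff_mul_comm, ← map_commutatorElement] at hc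
  exact (QuotientGroup.eq_one_iff _).1 hc

/-- Commutation with a fixed element as a homomorphism on a subgroup that centralizes all the
commutators obtained. -/
def commutatorHom (B D : Subgroup G) [IsMulCommutative D] (y : G) (hD : ∀ b ∈ B, ⁅b, y⁆ ∈ D)
    (hBD : ∀ b ∈ B, ∀ d ∈ D, b * d = d * b) : B →* D where
  toFun b := ⟨⁅(b : G), y⁆, hD b b.2⟩
  map_one' := by simp
  map_mul' a b := by
    -- Expanding `⁅a * b, y⁆` yields the factors in reverse order; commutativity of `D` swaps them.
    refine Eq.trans (Subtype.ext ?_)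
      (mul_comm (⟨⁅(b : G), y⁆, hD b b.2⟩ : D) ⟨⁅(a : G), y⁆, hD a a.2⟩)
    change ⁅(a * b : G), y⁆ = ⁅(b : G), y⁆ * ⁅(a : G), y⁆
    rw [commutatorElement_mul_left_eq_conj_mul, hBD a a.2 _ (hD b b.2),
      mul_inv_cancel_right]

/-- If `B` centralizes `⁅B, N⁆`, where `N` is the normal closure of a finite set `Y`, then every
element of `D = ⁅B, N⁆` is a product of commutators `⁅b, y⁆` and `⁅d, x⁆` with `b ∈ B`, `d ∈ D`,
one for each `y ∈ Y` and each `x` in a finite generating set. -/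
theorem exists_commutator_subset_pow {X Y : Set G} (hX : Subgroup.closure X = ⊤) (hXf : X.Finite)
    (hYf : Y.Finite) (hP : ∀ y : G, ∃ n : ℕ, ∀ u : G, ⁅u, y⁆ ∈ P ^ n) (B : Subgroup G) [B.Normal]
    (hB : ⁅B, ⁅B, Subgroup.normalClosure Y⁆⁆ = ⊥) :
    ∃ n : ℕ, ((⁅B, Subgroup.normalClosure Y⁆ : Subgroup G) : Set G) ⊆ P ^ n := by
  set D := ⁅B, Subgroup.normalClosure Y⁆ with hD
  have hDB : D ≤ B := Subgroup.commutator_le_left _ _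
  have hBD : ∀ b ∈ B, ∀ d ∈ D, b * d = d * b := by
    intro b hb d hd
    rw [← commutatorElement_eq_one_iff_mul_comm, ← Subgroup.mem_bot, ← hB]
    exact Subgroup.commutator_mem_commutator hb hd
  have hDc : IsMulCommutative D :=
    ⟨⟨fun a b => Subtype.ext (hBD a (hDB a.2) b b.2)⟩⟩
  have hDx : ∀ x : G, ∀ d ∈ D, ⁅d, x⁆ ∈ D := fun x d hd =>
    Subgroup.commutator_le_left D ⊤ (Subgroup.commutator_mem_commutator hd (Subgroup.mem_top x))
  have hDy : ∀ y ∈ Y, ∀ b ∈ B, ⁅b, y⁆ ∈ D := fun y hy b hb =>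
    Subgroup.commutator_mem_commutator hb (Subgroup.subset_normalClosure hy)
  have := hXf.to_subtype
  have := hYf.to_subtype
  let H : X ⊕ Y → Subgroup D := Sum.elim
    (fun x => (commutatorHom D D x (hDx x) fun b hb => hBD b (hDB hb)).range)
    (fun y => (commutatorHom B D y (hDy y y.2) hBD).range)
  obtain ⟨n, hn⟩ := exists_image_iSup_subset_pow (P := P) D.subtype H (by
    rintro (x | y)
    · obtain ⟨n, hn⟩ := hP x
      refine ⟨n, ?_⟩
      rintro _ ⟨_, ⟨d, rfl⟩, rfl⟩
      exact hn d
    · obtain ⟨n, hn⟩ := hP y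
      refine ⟨n, ?_⟩
      rintro _ ⟨_, ⟨b, rfl⟩, rfl⟩
      exact hn b)
  refine ⟨n, subset_trans ?_ hn⟩
  set S : Subgroup G := (⨆ i, H i).map D.subtype with hS
  have hSD : S ≤ D := Subgroup.map_subtype_le _
  have hSx : ∀ x ∈ X, ∀ d ∈ D, ⁅x, d⁆ ∈ S := by
    intro x hx d hd
    rw [← commutatorElement_inv]
    exact inv_mem ⟨_, le_iSup H (Sum.inl ⟨x, hx⟩) ⟨⟨d, hd⟩, rfl⟩, rfl⟩
  have hSy : ∀ b ∈ B, ∀ y ∈ Y, ⁅b, y⁆ ∈ S := fun b hb y hy =>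
    ⟨_, le_iSup H (Sum.inr ⟨y, hy⟩) ⟨⟨b, hb⟩, rfl⟩, rfl⟩
  -- The images of `d ↦ ⁅d, x⁆` are there for this: they force `⁅⊤, S⁆ ≤ ⁅⊤, D⁆ ≤ S`.
  have : S.Normal := Subgroup.commutator_top_left_le_iff.1
    ((Subgroup.commutator_mono le_rfl hSD).trans (commutator_top_le_of_closure hX hSD hSx))
  exact commutator_normalClosure_le hSy

/-- `H` is contained in `K` up to products of boundedly many elements of `P`. -/
def BoundedModulo (P : Set G) (H K : Subgroup G) : Prop :=
  ∃ n : ℕ, (H : Set G) ⊆ P ^ n * K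

theorem BoundedModulo.trans {H K L : Subgroup G} (h₁ : BoundedModulo P H K)
    (h₂ : BoundedModulo P K L) : BoundedModulo P H L := by
  obtain ⟨m, hm⟩ := h₁
  obtain ⟨n, hn⟩ := h₂
  refine ⟨m + n, hm.trans ?_⟩
  rw [pow_add, mul_assoc]
  exact Set.mul_subset_mul_left hn

theorem BoundedModulo.refl (H : Subgroup G) : BoundedModulo P H H := ⟨0, by simp⟩

/-- A chain of bounded steps is bounded. -/
theorem BoundedModulo.of_succ {L : ℕ → Subgroup G} (h : ∀ k, BoundedModulo P (L k) (L (k + 1)))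
    (n : ℕ) : BoundedModulo P (L 0) (L n) := by
  induction n with
  | zero => exact .refl _
  | succ n ih => exact ih.trans (h n)

theorem boundedModulo_of_image_subset {H C : Subgroup G} [C.Normal] {n : ℕ}
    (h : (H.map (QuotientGroup.mk' C) : Set (G ⧸ C)) ⊆ (QuotientGroup.mk' C '' P) ^ n) :
    BoundedModulo P H C := by
  refine ⟨n, fun g hg => ?_⟩
  have hg' := h ⟨g, hg, rfl⟩
  rw [← Set.image_pow] at hg'
  obtain ⟨p, hp, hpg⟩ := hg'
  exact ⟨p, hp, p⁻¹ * g, QuotientGroup.eq.1 hpg, mul_inv_cancel_left p g⟩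

theorem boundedModulo_commutator {X Y : Set G} (hX : Subgroup.closure X = ⊤) (hXf : X.Finite)
    (hYf : Y.Finite) (hP : ∀ y : G, ∃ n : ℕ, ∀ u : G, ⁅u, y⁆ ∈ P ^ n) {B N C : Subgroup G}
    [B.Normal] [C.Normal] (hN : N = Subgroup.normalClosure Y) (hC : ⁅B, ⁅B, N⁆⁆ ≤ C) :
    BoundedModulo P ⁅B, N⁆ C := by
  have hπ := QuotientGroup.mk'_surjective C
  have hB : (B.map (QuotientGroup.mk' C)).Normal := Subgroup.Normal.map ‹_› _ hπ
  have hNπ : N.map (QuotientGroup.mk' C) = Subgroup.normalClosure (QuotientGroup.mk' C '' Y) := by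
    rw [hN, Subgroup.map_normalClosure _ _ hπ]
  obtain ⟨n, hn⟩ := exists_commutator_subset_pow (P := QuotientGroup.mk' C '' P)
    (X := QuotientGroup.mk' C '' X) (Y := QuotientGroup.mk' C '' Y)
    (by rw [← MonoidHom.map_closure, hX, Subgroup.map_top_of_surjective _ hπ])
    (hXf.image _) (hYf.image _)
    (by
      intro y
      obtain ⟨y, rfl⟩ := hπ y
      obtain ⟨n, hn⟩ := hP y
      refine ⟨n, fun u => ?_⟩
      obtain ⟨u, rfl⟩ := hπ u
      rw [← map_commutatorElement, ← Set.image_pow]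
      exact ⟨_, hn u, rfl⟩)
    (B.map (QuotientGroup.mk' C))
    (by
      rw [← hNπ, ← Subgroup.map_commutator, ← Subgroup.map_commutator,
        (Subgroup.map_eq_bot_iff _).2]
      simpa using hC)
  refine boundedModulo_of_image_subset (n := n) ?_
  rwa [Subgroup.map_commutator, hNπ]

/-- The abelianization is a product of finitely many cyclic groups, each lying in the image of `P`.
-/
theorem boundedModulo_top_commutator {X : Set G} (hX : Subgroup.closure X = ⊤) (hXf : X.Finite)
    (hP : ∀ x ∈ X, ∀ k : ℤ, x ^ k ∈ P) : BoundedModulo P ⊤ (commutator G) := by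
  have := hXf.to_subtype
  obtain ⟨n, hn⟩ := exists_image_iSup_subset_pow (P := Abelianization.of '' P)
    (MonoidHom.id (Abelianization G)) (fun x : X => Subgroup.zpowers (Abelianization.of (x : G)))
    (by
      intro x
      refine ⟨1, ?_⟩
      rw [pow_one]
      rintro _ ⟨_, ⟨k, rfl⟩, rfl⟩
      exact ⟨_, hP x x.2 k, by simp⟩)
  refine boundedModulo_of_image_subset (n := n) ?_
  refine subset_trans ?_ hn
  have hsup : ⨆ x : X, Subgroup.zpowers (Abelianization.of (x : G)) = ⊤ := by
    rw [eq_top_iff, ← Subgroup.map_top_of_surjective Abelianization.of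
      (QuotientGroup.mk'_surjective _), ← hX, MonoidHom.map_closure, Subgroup.closure_le]
    rintro _ ⟨x, hx, rfl⟩
    exact le_iSup (fun x : X => Subgroup.zpowers (Abelianization.of (x : G))) ⟨x, hx⟩
      (Subgroup.mem_zpowers _)
  rw [hsup]
  intro g _
  exact ⟨g, trivial, rfl⟩

end BoundedWidth

/-! ### Lower central series and finite generation -/

section LowerCentralSeries

variable {G : Type*} [Group G]

theorem normal_lowerCentralSeries (N : Subgroup G) [N.Normal] (k : ℕ) :
    (N.lowerCentralSeries k).Normal := by
  induction k with
  | zero => assumption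
  | succ k ih => exact Subgroup.commutator_normal _ _

/-- The terms of the lower central series of a finitely generated group are normal closures of
finite sets. -/
theorem exists_finite_normalClosure_eq_lowerCentralSeries {X : Set G}
    (hX : Subgroup.closure X = ⊤) (hXf : X.Finite) (k : ℕ) :
    ∃ Y : Set G, Y.Finite ∧
      (⊤ : Subgroup G).lowerCentralSeries k = Subgroup.normalClosure Y := by
  have htop : Subgroup.normalClosure X = ⊤ :=
    top_le_iff.1 (hX ▸ Subgroup.closure_le_normalClosure)
  induction k with
  | zero => exact ⟨X, hXf, htop.symm⟩
  | succ k ih =>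
    obtain ⟨Y, hY, hk⟩ := ih
    set R := Subgroup.normalClosure (Set.image2 (fun y x => ⁅y, x⁆) Y X) with hR
    refine ⟨Set.image2 (fun y x => ⁅y, x⁆) Y X, hY.image2 _ hXf, le_antisymm ?_ ?_⟩
    · rw [Subgroup.lowerCentralSeries_succ, hk, Subgroup.commutator_comm]
      refine commutator_normalClosure_le fun g _ y hy => ?_
      -- Modulo `R`, `y` commutes with the generators, hence with everything.
      have hXy : X ⊆ (Subgroup.centralizer {(y : G ⧸ R)}).comap (QuotientGroup.mk' R) := by
        intro x hx
        rw [SetLike.mem_coe, Subgroup.mem_comap, Subgroup.mem_centralizer_singleton_iff, eq_comm,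
          ← QuotientGroup.mk'_apply, ← commutatorElement_eq_one_iff_mul_comm,
          ← map_commutatorElement]
        exact (QuotientGroup.eq_one_iff _).2
          (Subgroup.subset_normalClosure (Set.mem_image2_of_mem hy hx))
      have hg := (hX ▸ (Subgroup.closure_le _).2 hXy) (Subgroup.mem_top g)
      rw [Subgroup.mem_comap, Subgroup.mem_centralizer_singleton_iff,
        ← QuotientGroup.mk'_apply, ← commutatorElement_eq_one_iff_mul_comm,
        ← map_commutatorElement] at hg
      exact (QuotientGroup.eq_one_iff _).1 hg
    · have := normal_lowerCentralSeries (⊤ : Subgroup G) (k + 1)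
      refine Subgroup.normalClosure_le_normal ?_
      rintro _ ⟨y, hy, x, -, rfl⟩
      exact Subgroup.commutator_mem_commutator (hk ▸ Subgroup.subset_normalClosure hy)
        (Subgroup.mem_top x)

theorem exists_finite_subset_closure_eq_top [Group.FG G] {X : Set G}
    (hX : Subgroup.closure X = ⊤) :
    ∃ X₀ ⊆ X, X₀.Finite ∧ Subgroup.closure X₀ = ⊤ := by
  have hmem : ∀ g : G, ∃ X₀ ⊆ X, X₀.Finite ∧ g ∈ Subgroup.closure X₀ := by
    intro g
    have hg : g ∈ Subgroup.closure X := hX ▸ Subgroup.mem_top g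
    induction hg using Subgroup.closure_induction with
    | mem x hx =>
      exact ⟨{x}, by simpa using hx, Set.finite_singleton x, Subgroup.subset_closure rfl⟩
    | one => exact ⟨∅, by simp, Set.finite_empty, one_mem _⟩
    | mul a b _ _ ha hb =>
      obtain ⟨U, hU, hUf, ha⟩ := ha
      obtain ⟨V, hV, hVf, hb⟩ := hb
      exact ⟨U ∪ V, Set.union_subset hU hV, hUf.union hVf,
        mul_mem (Subgroup.closure_mono Set.subset_union_left ha)
          (Subgroup.closure_mono Set.subset_union_right hb)⟩
    | inv a _ ha =>
      obtain ⟨U, hU, hUf, ha⟩ := ha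
      exact ⟨U, hU, hUf, inv_mem ha⟩
  choose F hFX hFf hF using hmem
  obtain ⟨S, hS, hSf⟩ := Group.fg_iff.1 ‹Group.FG G›
  refine ⟨⋃ s ∈ S, F s, Set.iUnion₂_subset fun s _ => hFX s, hSf.biUnion fun s _ => hFf s, ?_⟩
  rw [eq_top_iff, ← hS, Subgroup.closure_le]
  exact fun s hs => Subgroup.closure_mono (Set.subset_biUnion_of_mem hs) (hF s)

theorem exists_lowerCentralSeries_le_of_isNilpotent_quotient (N : Subgroup G) [N.Normal]
    (h : Group.IsNilpotent (G ⧸ N)) : ∃ k, (⊤ : Subgroup G).lowerCentralSeries k ≤ N := by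
  obtain ⟨k, hk⟩ := Subgroup.nilpotent_iff_lowerCentralSeries.1 h
  refine ⟨k, ?_⟩
  rw [← Subgroup.map_top_of_surjective _ (QuotientGroup.mk'_surjective N),
    ← Subgroup.map_lowerCentralSeries, Subgroup.map_eq_bot_iff] at hk
  simpa using hk

/-- In an abelian-by-nilpotent-by-nilpotent group, some term of the lower central series of some
term of the lower central series is abelian. -/
theorem exists_commutator_lowerCentralSeries_eq_bot {G : Type u} [Group G]
    (hG : GroupClass.abelianByNilpotentByNilpotent G) :
    ∃ c d : ℕ, ⁅((⊤ : Subgroup G).lowerCentralSeries c).lowerCentralSeries d,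
      ((⊤ : Subgroup G).lowerCentralSeries c).lowerCentralSeries d⁆ = ⊥ := by
  obtain ⟨N, hN, ⟨A, hA, hAc, hNA⟩, hGN⟩ := hG
  obtain ⟨c, hc⟩ := exists_lowerCentralSeries_le_of_isNilpotent_quotient N hGN
  obtain ⟨d, hd⟩ := exists_lowerCentralSeries_le_of_isNilpotent_quotient A hNA
  refine ⟨c, d, ?_⟩
  have h : ((⊤ : Subgroup G).lowerCentralSeries c).lowerCentralSeries d ≤ A.map N.subtype := by
    refine (Subgroup.lowerCentralSeries_mono d hc).trans ?_
    change N.lowerCentralSeries d ≤ _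
    rw [← Subgroup.top_subtype_lowerCentralSeries]
    exact Subgroup.map_mono hd
  refine le_bot_iff.1 ((Subgroup.commutator_mono h h).trans ?_)
  rw [← Subgroup.map_commutator, Subgroup.commutator_self_eq_bot_iff.2 hAc, Subgroup.map_bot]

end LowerCentralSeries

/-! ### The descending chain and the theorem -/

/-- If some term of the lower central series of a term of the lower central series is abelian,
then `G` has bounded width with respect to every `P` that contains the cyclic subgroups of a finite
set of generators and in which commutators with a fixed element are bounded. -/
theorem boundedModulo_top_bot {G : Type*} [Group G] {P X : Set G}
    (hX : Subgroup.closure X = ⊤) (hXf : X.Finite) (hPX : ∀ x ∈ X, ∀ k : ℤ, x ^ k ∈ P)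
    (hP : ∀ y : G, ∃ n : ℕ, ∀ u : G, ⁅u, y⁆ ∈ P ^ n) {c d : ℕ}
    (hcd : ⁅((⊤ : Subgroup G).lowerCentralSeries c).lowerCentralSeries d,
      ((⊤ : Subgroup G).lowerCentralSeries c).lowerCentralSeries d⁆ = ⊥) :
    BoundedModulo P (⊤ : Subgroup G) ⊥ := by
  have htop : ⊤ = Subgroup.normalClosure X :=
    (top_le_iff.1 (hX ▸ Subgroup.closure_le_normalClosure)).symm
  obtain ⟨Y, hYf, hY⟩ := exists_finite_normalClosure_eq_lowerCentralSeries hX hXf c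
  have hstep : ∀ (M : Subgroup G) [M.Normal] (Z : Set G), Z.Finite → M = Subgroup.normalClosure Z →
      ∀ k, BoundedModulo P (M.lowerCentralSeries (k + 1)) (M.lowerCentralSeries (k + 1 + 1)) := by
    intro M _ Z hZf hZ k
    have := normal_lowerCentralSeries M k
    have := normal_lowerCentralSeries M (k + 1 + 1)
    refine boundedModulo_commutator hX hXf hZf hP hZ ?_
    rw [Subgroup.lowerCentralSeries_succ M (k + 1), Subgroup.lowerCentralSeries_succ M k,
      Subgroup.commutator_comm]
    exact Subgroup.commutator_mono le_rfl (Subgroup.lowerCentralSeries_le_self M k)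
  have hG : BoundedModulo P ((⊤ : Subgroup G).lowerCentralSeries 1)
      ((⊤ : Subgroup G).lowerCentralSeries (c + 1)) :=
    .of_succ (L := fun k => (⊤ : Subgroup G).lowerCentralSeries (k + 1))
      (hstep ⊤ X hXf htop) c
  set N := (⊤ : Subgroup G).lowerCentralSeries c with hN
  have hNn : N.Normal := normal_lowerCentralSeries ⊤ c
  have := normal_lowerCentralSeries N d
  -- The previous chain ends at `c + 1` because that term is `⁅N, ⊤⁆`, and `⁅N, ⁅N, ⊤⁆⁆ ≤ ⁅N, N⁆`.
  have hGN : BoundedModulo P ((⊤ : Subgroup G).lowerCentralSeries (c + 1))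
      (N.lowerCentralSeries 1) :=
    have := normal_lowerCentralSeries N 1
    boundedModulo_commutator hX hXf hXf hP htop
      (Subgroup.commutator_mono le_rfl (Subgroup.commutator_le_left _ _))
  have hNd : BoundedModulo P (N.lowerCentralSeries 1) (N.lowerCentralSeries (d + 1)) :=
    .of_succ (L := fun k => N.lowerCentralSeries (k + 1)) (hstep N Y hYf hY) d
  -- Here `B` is the abelian term `N.lowerCentralSeries d`, so `⁅B, ⁅B, N⁆⁆ ≤ ⁅B, B⁆ = ⊥`.
  have hbot : BoundedModulo P (N.lowerCentralSeries (d + 1)) ⊥ :=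
    boundedModulo_commutator hX hXf hYf hP hY
      ((Subgroup.commutator_mono le_rfl (Subgroup.commutator_le_left _ _)).trans hcd.le)
  exact ((((boundedModulo_top_commutator hX hXf hPX).trans hG).trans hGN).trans hNd).trans hbot

theorem palindromicLength_le_of_mem_pow {G : Type u} [Group G] {X : Set G} {g : G} {n : ℕ}
    (h : g ∈ {g | IsPalindromeIn X g} ^ n) : palindromicLength X g ≤ n := by
  suffices ∃ l : List G, (∀ p ∈ l, IsPalindromeIn X p) ∧ l.prod = g ∧ l.length = n by
    obtain ⟨l, hl, hg, hn⟩ := this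
    exact sInf_le ⟨l, hl, hg, by rw [hn]⟩
  induction n generalizing g with
  | zero => exact ⟨[], by simp, by simpa [eq_comm] using h, rfl⟩
  | succ n ih =>
    rw [pow_succ'] at h
    obtain ⟨p, hp, a, ha, rfl⟩ := h
    obtain ⟨l, hl, rfl, hn⟩ := ih ha
    exact ⟨p :: l, by simpa using ⟨hp, hl⟩, by simp, by simp [hn]⟩

theorem theorem1p2 (G : Type u) [Group G] [Group.FG G]
    (hG : GroupClass.abelianByNilpotentByNilpotent G)
    (X : Set G) (hX : Subgroup.closure X = ⊤) :
    palindromicWidth X < ⊤ := by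
  obtain ⟨X₀, hX₀, hX₀f, hX₀c⟩ := exists_finite_subset_closure_eq_top hX
  obtain ⟨c, d, hcd⟩ := exists_commutator_lowerCentralSeries_eq_bot hG
  -- Only the generators are cut down to `X₀`; palindromes are still taken over `X`.
  obtain ⟨n, hn⟩ := boundedModulo_top_bot (P := {g | IsPalindromeIn X g}) hX₀c hX₀f
    (fun x hx => isPalindromeIn_zpow (hX₀ hx)) (exists_forall_commutator_mem_pow_palindromes hX) hcd
  refine lt_of_le_of_lt (iSup_le fun g => ?_) (ENat.natCast_lt_top n)
  refine palindromicLength_le_of_mem_pow ?_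
  simpa using hn (Subgroup.mem_top g)
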